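/- Let $n \ge 1$ be an integer, write $[n]=\{1,\dots,n\}$, and let $r > 0$ be a real number. Let $$\Delta_r(n) = \Big\{x = (x_1,\dots,x_n) \in \mathbb{R}^n : x_i \ge 0 \text{ for all } i \in [n],\ \sum_{i=1}^n x_i = r\Big\}$$ be the set of mass distributions on $[n]$ with total mass $r$, with the topology induced from $\mathbb{R}^n$. A (general, nonatomic) Neighbourhood Balancing Game, or NBG, is a triple $(n, r, C)$ where $C = (C_i)_{i \in [n]}$ is a family of functions $C_i : \Delta_r(n) \to [0,\infty)$, called cost functions. An equilibrium of the game is a mass distribution $x^* \in \Delta_r(n)$ such that for all $i, j \in [n]$, $$x^*_i > 0 \implies C_i(x^*) \le C_j(x^*).$$ **Theorem.** Let $(n, r, C)$ be an NBG whose cost functions $C_i$, $i \in [n]$, are all continuous on $\Delta_r(n)$. Then the game has an equilibrium. -/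

import Mathlib

open scoped NNReal

/-- The set `Δ_r(n)` of mass distributions on `n` vertices with total mass `r`: the vectors with
nonnegative real entries that sum to `r`. The vertices `1, …, n` are represented by `Fin n`. -/
def massDistributions (n : ℕ) (r : ℝ) : Set (Fin n → ℝ) :=
  {x | (∀ i, 0 ≤ x i) ∧ ∑ i, x i = r}

/-- A (general, nonatomic) neighbourhood balancing game `(n, r, C)`: a number `n ≥ 1` of vertices,
a total mass `r > 0`, and for each vertex `i` a nonnegative real cost function
`C i` on `Δ_r(n)`. -/
structure NBG where
  n : ℕ
  one_le_n : 1 ≤ n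
  r : ℝ
  r_pos : 0 < r
  C : Fin n → massDistributions n r → ℝ≥0

/-- A vertex is charged under `x` if it carries positive mass. -/
def NBG.IsCharged (G : NBG) (x : massDistributions G.n G.r) (i : Fin G.n) : Prop :=
  0 < (x : Fin G.n → ℝ) i

/-- A mass distribution is an equilibrium if every charged vertex has cost at most the cost of
any vertex. -/
def NBG.IsEquilibrium (G : NBG) (x : massDistributions G.n G.r) : Prop :=
  ∀ i j : Fin G.n, G.IsCharged x i → G.C i x ≤ G.C j x

/-! Label each point of a fine grid on the simplex by a cheapest vertex. Scarf's lemma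
(`exists_dominant_colourful`), applied to the coordinates as ranks together with one slack point per
vertex, gives a dominant set with every colour once. Dominance forbids a grid point above all its
minima, so these minima nearly exhaust the total mass. Hence its grid points lie close together, and
each vertex coloured by a slack point has small mass there (`exists_grid_cluster`). Refine the grid
and pass to a limit by compactness: a vertex charged in the limit is cheapest at points converging
to it, and continuity gives equilibrium.

Scarf's lemma is a parity argument. Rooms are dominant sets of full size; doors have one point fewer
and carry all colours but `i₀`. Without a colourful room, every room contains an even number of
doors. Each door lies in an even number of rooms, except the all-slack door, which lies in exactly
one; counting incidences both ways is a contradiction. -/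

/-- A finite set `S` is dominant for a family of ranks `u i` if no point lies strictly above the
`u i`-minimum of `S` for all `i` at once. -/
def Dominant {I X α : Type*} [LinearOrder α] (u : I → X → α) (S : Finset X) : Prop :=
  ∀ y, ∃ i, ∀ x ∈ S, u i y ≤ u i x

theorem Dominant.mono {I X α : Type*} [LinearOrder α] {u : I → X → α} {S T : Finset X}
    (hST : S ⊆ T) (hT : Dominant u T) : Dominant u S := fun y =>
  let ⟨i, hi⟩ := hT y
  ⟨i, fun x hx => hi x (hST hx)⟩

/-! ### Pivoting: extensions of a dominant set by one point. -/

section Pivot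

set_option linter.unusedSectionVars false

variable {I X α : Type*} [Fintype I] [DecidableEq I] [Fintype X] [DecidableEq X] [LinearOrder α]
  {u : I → X → α}

/-- The points above the chosen minima `m l` for every index `l` other than `k`. -/
def pivotCandidates (u : I → X → α) (m : I → X) (k : I) : Finset X :=
  {y | ∀ l, l ≠ k → u l (m l) < u l y}

/-- The `u k`-maximal points among the pivot candidates at `k`. -/
def pivots (u : I → X → α) (m : I → X) (k : I) : Finset X :=
  {y ∈ pivotCandidates u m k | ∀ z ∈ pivotCandidates u m k, u k z ≤ u k y}

theorem mem_pivotCandidates {m : I → X} {k : I} {y : X} :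
    y ∈ pivotCandidates u m k ↔ ∀ l, l ≠ k → u l (m l) < u l y := by
  simp [pivotCandidates]

theorem mem_pivots {m : I → X} {k : I} {y : X} :
    y ∈ pivots u m k ↔ y ∈ pivotCandidates u m k ∧
      ∀ z ∈ pivotCandidates u m k, u k z ≤ u k y := by
  simp [pivots]

theorem card_pivots_of_nonempty (hu : ∀ i, Function.Injective (u i)) {m : I → X} {k : I}
    (h : (pivotCandidates u m k).Nonempty) : (pivots u m k).card = 1 := by
  obtain ⟨y, hy, hmax⟩ := Finset.exists_max_image _ (u k) h
  rw [Finset.card_eq_one]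
  refine ⟨y, Finset.eq_singleton_iff_unique_mem.2 ⟨mem_pivots.2 ⟨hy, hmax⟩, fun z hz => ?_⟩⟩
  rw [mem_pivots] at hz
  exact hu k (le_antisymm (hmax z hz.1) (hz.2 y hy))

theorem card_pivots_of_empty {m : I → X} {k : I}
    (h : ¬ (pivotCandidates u m k).Nonempty) : (pivots u m k).card = 0 := by
  rw [Finset.not_nonempty_iff_eq_empty] at h
  simp [pivots, h]

/-- The points that extend `τ` to a larger dominant set. -/
noncomputable def extensions (u : I → X → α) (τ : Finset X) : Finset X := by
  classical exact {y | y ∉ τ ∧ Dominant u (insert y τ)}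

theorem mem_extensions {τ : Finset X} {y : X} :
    y ∈ extensions u τ ↔ y ∉ τ ∧ Dominant u (insert y τ) := by
  simp [extensions]

theorem exists_minima (u : I → X → α) {τ : Finset X} (hτ : τ.Nonempty) :
    ∃ m : I → X, ∀ i, m i ∈ τ ∧ ∀ x ∈ τ, u i (m i) ≤ u i x :=
  Classical.axiom_of_choice (r := fun i y => y ∈ τ ∧ ∀ x ∈ τ, u i y ≤ u i x) fun i =>
    Finset.exists_min_image τ (u i) hτ

theorem image_minima_of_dominant (hu : ∀ i, Function.Injective (u i)) {τ : Finset X} {m : I → X}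
    (hm : ∀ i, m i ∈ τ ∧ ∀ x ∈ τ, u i (m i) ≤ u i x) (hd : Dominant u τ) {x : X} (hx : x ∈ τ) :
    ∃ i, m i = x := by
  obtain ⟨i, hi⟩ := hd x
  exact ⟨i, hu i (le_antisymm ((hm i).2 x hx) (hi _ (hm i).1))⟩

/-- Two indices have the same minimum on a dominant set with one point fewer than there are
indices. -/
theorem exists_minima_collision {τ : Finset X} {m : I → X}
    (hm : ∀ i, m i ∈ τ ∧ ∀ x ∈ τ, u i (m i) ≤ u i x) (hcard : τ.card + 1 = Fintype.card I) :
    ∃ i j, i ≠ j ∧ m i = m j := by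
  obtain ⟨i, -, j, -, hij, h⟩ := Finset.exists_ne_map_eq_of_card_lt_of_maps_to
    (s := (Finset.univ : Finset I)) (t := τ) (f := m) (by rw [Finset.card_univ]; omega)
    (fun i _ => (hm i).1)
  exact ⟨i, j, hij, h⟩

/-- In the extended set each point is the minimum for its own index `g x`, and counting makes `g` a
bijection onto the indices. So `m` is injective away from `g y`, and the collision must involve `g
y`. -/
theorem mem_pivots_of_mem_extensions (hu : ∀ i, Function.Injective (u i)) {τ : Finset X}
    {m : I → X} (hm : ∀ i, m i ∈ τ ∧ ∀ x ∈ τ, u i (m i) ≤ u i x)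
    (hcard : τ.card + 1 = Fintype.card I) {i j : I} (hij : i ≠ j) (hmij : m i = m j) {y : X}
    (hy : y ∈ extensions u τ) : y ∈ pivots u m i ∪ pivots u m j := by
  obtain ⟨hyτ, hd⟩ := mem_extensions.1 hy
  choose g hg using hd
  have hginj : Set.InjOn g (insert y τ : Finset X) := fun a ha b hb hab =>
    hu (g a) (le_antisymm (hg a b hb) (hab ▸ hg b a ha))
  have hgsurj : ∀ l, ∃ x ∈ insert y τ, g x = l := by
    have : (insert y τ).image g = Finset.univ := by
      rw [← Finset.card_eq_iff_eq_univ, Finset.card_image_of_injOn hginj,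
        Finset.card_insert_of_notMem hyτ, hcard]
    intro l
    exact Finset.mem_image.1 (this ▸ Finset.mem_univ l)
  have hgm : ∀ x ∈ τ, m (g x) = x := fun x hx =>
    hu (g x) (le_antisymm ((hm _).2 x hx) (hg x _ (Finset.mem_insert_of_mem (hm _).1)))
  have hout : ∀ l, l ≠ g y → m l ∈ τ ∧ g (m l) = l := by
    intro l hl
    obtain ⟨x, hx, rfl⟩ := hgsurj l
    have hxτ : x ∈ τ := (Finset.mem_insert.1 hx).resolve_left (fun h => hl (h ▸ rfl))
    rw [hgm x hxτ]
    exact ⟨hxτ, rfl⟩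
  have hk : g y = i ∨ g y = j := by
    by_contra! h
    apply hij
    rw [← (hout i h.1.symm).2, ← (hout j h.2.symm).2, hmij]
  have hpiv : y ∈ pivots u m (g y) := by
    have hmem : y ∈ pivotCandidates u m (g y) := by
      refine mem_pivotCandidates.2 fun l hl => lt_of_le_of_ne ?_ fun h => ?_
      · have := hg (m l) y (Finset.mem_insert_self _ _)
        rwa [(hout l hl).2] at this
      · exact hyτ (hu l h ▸ (hm l).1)
    refine mem_pivots.2 ⟨hmem, fun z hz => ?_⟩
    -- A candidate `z` can only be blocked at `g y`, since it lies above `m l` for every other `l`.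
    by_cases hl : g z = g y
    · exact hl ▸ hg z y (Finset.mem_insert_self _ _)
    · exact absurd (hg z _ (Finset.mem_insert_of_mem (hm (g z)).1))
        (not_le.2 (mem_pivotCandidates.1 hz _ hl))
  rcases hk with h | h
  · exact Finset.mem_union_left _ (h ▸ hpiv)
  · exact Finset.mem_union_right _ (h ▸ hpiv)

/-- Adding `y` lowers only the minimum at `i`; the other minima, including `m j = m i`, survive.
Candidates are then blocked at `i` by maximality of `y`, and all other points at some `l ≠ i` as
before. -/
theorem mem_extensions_of_mem_pivots (hu : ∀ i, Function.Injective (u i)) {τ : Finset X}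
    {m : I → X} (hm : ∀ i, m i ∈ τ ∧ ∀ x ∈ τ, u i (m i) ≤ u i x) (hd : Dominant u τ) {i j : I}
    (hij : i ≠ j) (hmij : m i = m j) {y : X} (hy : y ∈ pivots u m i) : y ∈ extensions u τ := by
  obtain ⟨hyc, hmax⟩ := mem_pivots.1 hy
  have hlow : ∀ x ∈ τ, u i y ≤ u i x := by
    obtain ⟨l, hl⟩ := hd y
    by_cases h : l = i
    · exact h ▸ hl
    · exact absurd (hl _ (hm l).1) (not_le.2 (mem_pivotCandidates.1 hyc l h))
  refine mem_extensions.2 ⟨fun hyτ => ?_, fun z => ?_⟩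
  · obtain ⟨l, hl⟩ := image_minima_of_dominant hu hm hd hyτ
    by_cases h : l = i
    · have := mem_pivotCandidates.1 hyc j hij.symm
      rw [← hmij, ← h, hl] at this
      exact lt_irrefl _ this
    · have := mem_pivotCandidates.1 hyc l h
      rw [hl] at this
      exact lt_irrefl _ this
  · by_cases hz : z ∈ pivotCandidates u m i
    · refine ⟨i, fun x hx => ?_⟩
      rcases Finset.mem_insert.1 hx with rfl | hx
      · exact hmax z hz
      · exact (hmax z hz).trans (hlow x hx)
    · rw [mem_pivotCandidates] at hz
      push Not at hz
      obtain ⟨l, hl, hzl⟩ := hz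
      refine ⟨l, fun x hx => ?_⟩
      rcases Finset.mem_insert.1 hx with rfl | hx
      · exact hzl.trans (mem_pivotCandidates.1 hyc l hl).le
      · exact hzl.trans ((hm l).2 x hx)

theorem card_extensions (hu : ∀ i, Function.Injective (u i)) {τ : Finset X}
    {m : I → X} (hm : ∀ i, m i ∈ τ ∧ ∀ x ∈ τ, u i (m i) ≤ u i x)
    (hcard : τ.card + 1 = Fintype.card I) (hd : Dominant u τ) {i j : I}
    (hij : i ≠ j) (hmij : m i = m j) :
    (extensions u τ).card = (pivots u m i).card + (pivots u m j).card := by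
  rw [← Finset.card_union_of_disjoint]
  · congr 1
    ext y
    refine ⟨mem_pivots_of_mem_extensions hu hm hcard hij hmij, fun hy => ?_⟩
    rcases Finset.mem_union.1 hy with hy | hy
    · exact mem_extensions_of_mem_pivots hu hm hd hij hmij hy
    · exact mem_extensions_of_mem_pivots hu hm hd hij.symm hmij.symm hy
  -- A common pivot would lie above every minimum of `τ`, against dominance.
  · refine Finset.disjoint_left.2 fun y hi hj => ?_
    obtain ⟨l, hl⟩ := hd y
    refine absurd (hl _ (hm l).1) (not_le.2 ?_)
    by_cases h : l = i
    · exact mem_pivotCandidates.1 (mem_pivots.1 hj).1 l (h ▸ hij)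
    · exact mem_pivotCandidates.1 (mem_pivots.1 hi).1 l h

end Pivot

/-! ### Scarf's lemma by counting doors and rooms. -/

section Scarf

set_option linter.unusedSectionVars false

variable {I X α : Type*} [Fintype I] [DecidableEq I] [Fintype X] [DecidableEq X] [LinearOrder α]

/-- A family of ranks `u` with slack points `e i`: each `u i` is injective, `e i` is the lowest
point for `u i`, and for `u j` with `j ≠ i` it is above all points that are not slack. -/
structure IsSlackFamily (u : I → X → α) (e : I → X) : Prop where
  injective : ∀ i, Function.Injective (u i)
  lowest : ∀ i x, u i (e i) ≤ u i x
  above : ∀ i j x, j ≠ i → x ∉ Set.range e → u j x < u j (e i)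

variable {u : I → X → α} {e : I → X}

/-- The non-slack point `t` keeps the minima low enough for `e k` to be a candidate at every `k`, so
both pivots exist; a non-dominant `τ` has no extension. -/
theorem even_card_extensions (h : IsSlackFamily u e) {τ : Finset X} {t : X} (ht : t ∈ τ)
    (hte : t ∉ Set.range e) (hcard : τ.card + 1 = Fintype.card I) :
    Even (extensions u τ).card := by
  by_cases hd : Dominant u τ
  · obtain ⟨m, hm⟩ := exists_minima u ⟨t, ht⟩
    obtain ⟨i, j, hij, hmij⟩ := exists_minima_collision hm hcard
    have hne : ∀ k, (pivotCandidates u m k).Nonempty := fun k =>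
      ⟨e k, mem_pivotCandidates.2 fun l hl => ((hm l).2 t ht).trans_lt (h.above k l t hl hte)⟩
    rw [card_extensions h.injective hm hcard hd hij hmij,
      card_pivots_of_nonempty h.injective (hne i), card_pivots_of_nonempty h.injective (hne j)]
    exact even_two
  · have : extensions u τ = ∅ := by
      ext y
      simp only [mem_extensions, Finset.notMem_empty, iff_false, not_and]
      exact fun _ hy => hd (hy.mono (Finset.subset_insert _ _))
    simp [this]

theorem IsSlackFamily.slack_injective (h : IsSlackFamily u e) {t : X} (hte : t ∉ Set.range e) :
    Function.Injective e := by
  intro i j hij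
  by_contra hne
  have h1 := h.above i j t (Ne.symm hne) hte
  rw [hij] at h1
  exact absurd (h.lowest j t) (not_le.2 h1)

theorem IsSlackFamily.lowest_lt (h : IsSlackFamily u e) {i : I} {x : X} (hx : x ≠ e i) :
    u i (e i) < u i x :=
  lt_of_le_of_ne (h.lowest i x) fun hh => hx (h.injective i hh).symm

/-- The minimum at `i₀` is some `e j`. Pivoting at `i₀` succeeds, as `t` is a candidate; pivoting at
`j` fails, as nothing lies above `e j` for `u i₀` and above the remaining minima. -/
theorem card_extensions_slack (h : IsSlackFamily u e) {t : X} (hte : t ∉ Set.range e) (i₀ : I)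
    (hI : 2 ≤ Fintype.card I) :
    (extensions u ((Finset.univ.erase i₀).image e)).card = 1 := by
  have he := h.slack_injective hte
  set τ := (Finset.univ.erase i₀).image e with hτ
  have hmem : ∀ l, l ≠ i₀ → e l ∈ τ := fun l hl =>
    Finset.mem_image_of_mem _ (Finset.mem_erase.2 ⟨hl, Finset.mem_univ l⟩)
  have hmem' : ∀ x ∈ τ, ∃ l, l ≠ i₀ ∧ e l = x := fun x hx => by
    simpa [hτ] using hx
  have hcard : τ.card + 1 = Fintype.card I := by
    rw [hτ, Finset.card_image_of_injective _ he, Finset.card_erase_of_mem (Finset.mem_univ _),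
      Finset.card_univ]
    omega
  have hd : Dominant u τ := by
    intro y
    by_cases hy : ∃ l, l ≠ i₀ ∧ e l = y
    · obtain ⟨l, -, rfl⟩ := hy
      exact ⟨l, fun x _ => h.lowest l x⟩
    · refine ⟨i₀, fun x hx => ?_⟩
      by_cases hy0 : e i₀ = y
      · exact hy0 ▸ h.lowest i₀ x
      · obtain ⟨l, hl, rfl⟩ := hmem' x hx
        refine (h.above l i₀ y hl.symm ?_).le
        rintro ⟨l', rfl⟩
        exact hy ⟨l', fun hh => hy0 (hh ▸ rfl), rfl⟩
  obtain ⟨m, hm⟩ := exists_minima u (τ := τ) (Finset.card_pos.1 (by omega))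
  have hml : ∀ l, l ≠ i₀ → m l = e l := fun l hl =>
    h.injective l (le_antisymm ((hm l).2 _ (hmem l hl)) (h.lowest l _))
  obtain ⟨j, hj, hmj⟩ : ∃ j, i₀ ≠ j ∧ m i₀ = m j := by
    obtain ⟨l, hl, hl'⟩ := hmem' _ (hm i₀).1
    exact ⟨l, hl.symm, by rw [hml l hl, hl']⟩
  rw [card_extensions h.injective hm hcard hd hj hmj,
    card_pivots_of_nonempty h.injective ⟨t, mem_pivotCandidates.2 fun l hl => ?_⟩,
    card_pivots_of_empty]
  · rintro ⟨y, hy⟩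
    rw [mem_pivotCandidates] at hy
    have h0 := hy i₀ hj
    rw [hmj, hml j hj.symm] at h0
    by_cases hye : y ∈ Set.range e
    · obtain ⟨l, rfl⟩ := hye
      by_cases hl : l = i₀
      · subst hl
        exact absurd (h.lowest l (e j)) (not_le.2 h0)
      · by_cases hlj : l = j
        · exact lt_irrefl _ (hlj ▸ h0)
        · have := hy l hlj
          rw [hml l hl] at this
          exact lt_irrefl _ this
    · exact lt_asymm h0 (h.above j i₀ y hj hye)
  · rw [hml l hl]
    exact h.lowest_lt fun hh => hte ⟨l, hh.symm⟩

/-- A set with as many points as there are colours, not all of which occur, contains an even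
number of points whose removal leaves exactly the colours other than `i₀`. -/
theorem even_card_doors {c : X → I} {i₀ : I} {S : Finset X} (hS : S.card = Fintype.card I)
    (hc : S.image c ≠ Finset.univ) :
    Even (S.filter fun x => (S.erase x).image c = Finset.univ.erase i₀).card := by
  rcases Finset.eq_empty_or_nonempty
    (S.filter fun x => (S.erase x).image c = Finset.univ.erase i₀) with h0 | ⟨x, hx⟩
  · simp [h0]
  obtain ⟨hxS, hx⟩ := Finset.mem_filter.1 hx
  have himg : S.image c = insert (c x) (Finset.univ.erase i₀) := by
    rw [← hx, ← Finset.image_insert, Finset.insert_erase hxS]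
  have hcx : c x ≠ i₀ := fun h => hc (by rw [himg, h, Finset.insert_erase (Finset.mem_univ _)])
  have hinj : Set.InjOn c (S.erase x : Finset X) := by
    rw [← Finset.card_image_iff, hx, Finset.card_erase_of_mem (Finset.mem_univ _),
      Finset.card_erase_of_mem hxS, hS, Finset.card_univ]
  -- The colour of `x` is repeated exactly once; the removable points are this pair.
  obtain ⟨x', hx'S, hx'⟩ : ∃ x' ∈ S.erase x, c x' = c x := by
    rw [← Finset.mem_image, hx]
    simp [hcx]
  have hne : x' ≠ x := (Finset.mem_erase.1 hx'S).1
  have : (S.filter fun x => (S.erase x).image c = Finset.univ.erase i₀) = {x, x'} := by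
    ext y
    simp only [Finset.mem_filter, Finset.mem_insert, Finset.mem_singleton]
    constructor
    · rintro ⟨hyS, hy⟩
      by_contra! hyn
      have hinj' : Set.InjOn c (S.erase y : Finset X) := by
        rw [← Finset.card_image_iff, hy, Finset.card_erase_of_mem (Finset.mem_univ _),
          Finset.card_erase_of_mem hyS, hS, Finset.card_univ]
      exact hne (hinj' (Finset.mem_erase.2 ⟨hyn.2.symm, (Finset.mem_erase.1 hx'S).2⟩)
        (Finset.mem_erase.2 ⟨hyn.1.symm, hxS⟩) hx')
    · rintro (rfl | rfl)
      · exact ⟨hxS, hx⟩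
      · refine ⟨(Finset.mem_erase.1 hx'S).2, ?_⟩
        rw [← hx]
        have e1 : S.erase x = insert y ((S.erase x).erase y) := (Finset.insert_erase hx'S).symm
        have e2 : S.erase y = insert x ((S.erase x).erase y) := by
          rw [Finset.erase_right_comm, Finset.insert_erase]
          exact Finset.mem_erase.2 ⟨hne.symm, hxS⟩
        rw [e1, e2, Finset.image_insert, Finset.image_insert, hx']
  rw [this, Finset.card_pair hne.symm]
  exact even_two

/-- **Scarf's lemma**: there is a dominant set that contains every colour exactly once. -/
theorem exists_dominant_colourful (h : IsSlackFamily u e) {t : X} (hte : t ∉ Set.range e)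
    (hI : 2 ≤ Fintype.card I) (c : X → I) (hc : ∀ i, c (e i) = i) :
    ∃ S : Finset X, S.card = Fintype.card I ∧ Dominant u S ∧ S.image c = Finset.univ := by
  classical
  by_contra! hno
  obtain ⟨i₀⟩ : Nonempty I := Fintype.card_pos_iff.1 (by omega)
  let R : Finset (Finset X) := {S | S.card = Fintype.card I ∧ Dominant u S}
  let D : Finset (Finset X) :=
    {τ | τ.card + 1 = Fintype.card I ∧ τ.image c = Finset.univ.erase i₀}
  have hcount := Finset.sum_card_bipartiteAbove_eq_sum_card_bipartiteBelow
    (s := D) (t := R) (fun τ S => τ ⊆ S)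
  have hroom : ∀ S ∈ R, Even (D.bipartiteBelow (fun τ S => τ ⊆ S) S).card := by
    intro S hS
    obtain ⟨hScard, hSd⟩ := (Finset.mem_filter.1 hS).2
    have hE := even_card_doors (i₀ := i₀) hScard (hno S hScard hSd)
    convert hE using 1
    symm
    refine Finset.card_bij (fun x _ => S.erase x) ?_ ?_ ?_
    · intro x hx
      obtain ⟨hxS, hx⟩ := Finset.mem_filter.1 hx
      refine Finset.mem_filter.2 ⟨Finset.mem_filter.2 ⟨Finset.mem_univ _, ?_, hx⟩,
        Finset.erase_subset _ _⟩
      rw [Finset.card_erase_add_one hxS, hScard]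
    · intro x hx y hy hxy
      exact (Finset.erase_inj S (Finset.mem_filter.1 hx).1).1 hxy
    · intro τ hτ
      obtain ⟨hτD, hτS⟩ := Finset.mem_filter.1 hτ
      obtain ⟨-, hτcard, hτc⟩ := Finset.mem_filter.1 hτD
      obtain ⟨x, hx, rfl⟩ : ∃ x ∉ τ, insert x τ = S :=
        (Finset.covBy_iff_exists_insert.1 (Finset.covBy_iff_card_sdiff_eq_one.2 ⟨hτS, by
          rw [Finset.card_sdiff_of_subset hτS]; omega⟩))
      have hex := Finset.erase_insert hx
      exact ⟨x, Finset.mem_filter.2 ⟨Finset.mem_insert_self _ _, by rw [hex, hτc]⟩, hex⟩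
  have hdoor : ∀ τ ∈ D, (R.bipartiteAbove (fun τ S => τ ⊆ S) τ).card = (extensions u τ).card := by
    intro τ hτ
    obtain ⟨-, hτcard, hτc⟩ := Finset.mem_filter.1 hτ
    symm
    refine Finset.card_bij (fun y _ => insert y τ) ?_ ?_ ?_
    · intro y hy
      obtain ⟨hyτ, hyd⟩ := mem_extensions.1 hy
      refine Finset.mem_filter.2 ⟨Finset.mem_filter.2 ⟨Finset.mem_univ _, ?_, hyd⟩,
        Finset.subset_insert _ _⟩
      rw [Finset.card_insert_of_notMem hyτ, hτcard]
    · intro x hx y hy hxy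
      exact (Finset.insert_inj (mem_extensions.1 hx).1).1 hxy
    · intro S hS
      obtain ⟨hSR, hτS⟩ := Finset.mem_filter.1 hS
      obtain ⟨-, hScard, hSd⟩ := Finset.mem_filter.1 hSR
      obtain ⟨x, hx, rfl⟩ : ∃ x ∉ τ, insert x τ = S :=
        (Finset.covBy_iff_exists_insert.1 (Finset.covBy_iff_card_sdiff_eq_one.2 ⟨hτS, by
          rw [Finset.card_sdiff_of_subset hτS]; omega⟩))
      exact ⟨x, mem_extensions.2 ⟨hx, hSd⟩, rfl⟩
  have he := h.slack_injective hte
  have hslack : (Finset.univ.erase i₀).image e ∈ D := by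
    refine Finset.mem_filter.2 ⟨Finset.mem_univ _, ?_, ?_⟩
    · rw [Finset.card_image_of_injective _ he, Finset.card_erase_add_one (Finset.mem_univ _),
        Finset.card_univ]
    · rw [Finset.image_image]
      rw [show c ∘ e = id from funext hc, Finset.image_id]
  have hother : ∀ τ ∈ D.erase ((Finset.univ.erase i₀).image e), Even (extensions u τ).card := by
    intro τ hτ
    obtain ⟨hne, hτ⟩ := Finset.mem_erase.1 hτ
    obtain ⟨-, hτcard, hτc⟩ := Finset.mem_filter.1 hτ
    by_cases hall : ∀ x ∈ τ, x ∈ Set.range e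
    · refine absurd (Finset.eq_of_subset_of_card_le (fun x hx => ?_) ?_) hne
      · obtain ⟨l, rfl⟩ := hall x hx
        refine Finset.mem_image_of_mem _ ?_
        rw [← hτc, ← hc l]
        simpa [hc] using Finset.mem_image_of_mem c hx
      · have := (Finset.mem_filter.1 hslack).2.1
        omega
    · push Not at hall
      obtain ⟨x, hx, hxe⟩ := hall
      exact even_card_extensions h hx hxe hτcard
  rw [Finset.sum_congr rfl hdoor, ← Finset.add_sum_erase _ _ hslack,
    card_extensions_slack h hte i₀ hI] at hcount
  have h1 : Even (∑ τ ∈ D.erase ((Finset.univ.erase i₀).image e), (extensions u τ).card) :=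
    Finset.even_sum _ hother
  have h2 := Finset.even_sum _ hroom
  rw [← hcount, Nat.even_add] at h2
  exact Nat.not_even_one (h2.2 h1)

end Scarf

/-! ### Scarf's lemma on the integer grid. -/

section Grid

variable {n k : ℕ}

/-- The integer coordinates of the grid points of total mass `k`, and of one slack point for each
coordinate. -/
def gridCoord (n k : ℕ) (i : Fin n) : {x : Fin n → ℕ // ∑ i, x i = k} ⊕ Fin n → ℤ
  | Sum.inl x => x.1 i
  | Sum.inr j => if i = j then -1 else k + 1

instance finiteGrid : Finite {x : Fin n → ℕ // ∑ i, x i = k} :=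
  Set.Finite.to_subtype <| (Set.finite_Iic (fun _ : Fin n => k)).subset fun x hx i => by
    rw [← show ∑ i, x i = k from hx]
    exact Finset.single_le_sum (fun _ _ => Nat.zero_le _) (Finset.mem_univ i)

theorem grid_le (x : {x : Fin n → ℕ // ∑ i, x i = k}) (i : Fin n) : x.1 i ≤ k :=
  (Finset.single_le_sum (fun _ _ => Nat.zero_le _) (Finset.mem_univ i)).trans_eq x.2

/-- Coordinates with ties broken by an enumeration of the points. -/
def gridRank {N : ℕ} (φ : {x : Fin n → ℕ // ∑ i, x i = k} ⊕ Fin n ≃ Fin N) (i : Fin n)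
    (x : {x : Fin n → ℕ // ∑ i, x i = k} ⊕ Fin n) : ℤ ×ₗ Fin N :=
  toLex (gridCoord n k i x, φ x)

variable {N : ℕ} {φ : {x : Fin n → ℕ // ∑ i, x i = k} ⊕ Fin n ≃ Fin N}

theorem gridRank_lt {i : Fin n} {x y : {x : Fin n → ℕ // ∑ i, x i = k} ⊕ Fin n}
    (h : gridCoord n k i x < gridCoord n k i y) : gridRank φ i x < gridRank φ i y :=
  Prod.Lex.toLex_lt_toLex.2 (Or.inl h)

/-- Grid coordinates lie between `0` and `k`, strictly between the slack values `-1` and `k + 1`;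
the tie-break gives injectivity. -/
theorem isSlackFamily_gridRank :
    IsSlackFamily (gridRank φ) (Sum.inr : Fin n → {x : Fin n → ℕ // ∑ i, x i = k} ⊕ Fin n) where
  injective i x y h := φ.injective (congrArg (fun p => (ofLex p).2) h)
  lowest i x := by
    rcases x with x | j
    · exact (gridRank_lt (by simp only [gridCoord, if_true]; omega)).le
    · by_cases h : i = j
      · rw [h]
      · exact (gridRank_lt (by simp only [gridCoord, if_true, if_neg h]; omega)).le
  above i j x hij hx := by
    rcases x with x | l
    · refine gridRank_lt ?_
      have := grid_le x j
      simp only [gridCoord, if_neg hij]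
      omega
    · exact absurd ⟨l, rfl⟩ hx

/-- Given lower bounds with sum at most `k` on a nonempty set of coordinates, some grid point
satisfies them. -/
theorem exists_grid_ge (m : Fin n → ℕ) {C : Finset (Fin n)} (hC : C.Nonempty)
    (hm : ∑ i ∈ C, m i ≤ k) :
    ∃ y : Fin n → ℕ, ∑ i, y i = k ∧ ∀ i ∈ C, m i ≤ y i := by
  obtain ⟨i₁, hi₁⟩ := hC
  -- All surplus mass goes to the single coordinate `i₁`.
  refine ⟨fun i => (if i ∈ C then m i else 0) + if i = i₁ then k - ∑ i ∈ C, m i else 0, ?_, ?_⟩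
  · rw [Finset.sum_add_distrib, Finset.sum_ite_mem, Finset.univ_inter, Finset.sum_ite_eq']
    simp only [Finset.mem_univ, if_true]
    omega
  · intro i hi
    simp [hi]

/-- For every labelling of the grid of total mass `k` there is a grid point near which all labels
occur, except those whose coordinate is small. -/
theorem exists_grid_cluster (hn : 1 ≤ n) (c : {x : Fin n → ℕ // ∑ i, x i = k} → Fin n) :
    ∃ x : {x : Fin n → ℕ // ∑ i, x i = k}, ∀ i, x.1 i ≤ n ∨
      ∃ y, c y = i ∧ ∀ j, y.1 j ≤ x.1 j + n ∧ x.1 j ≤ y.1 j + n := by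
  classical
  obtain ⟨t₀, ht₀, -⟩ := exists_grid_ge (k := k) (fun _ : Fin n => 0) (C := {⟨0, hn⟩}) (by simp)
    (by simp)
  -- Scarf's lemma needs two indices; for `n = 1` there is only one label.
  rcases hn.eq_or_lt with h1 | h2
  · subst h1
    exact ⟨⟨t₀, ht₀⟩, fun i => Or.inr ⟨⟨t₀, ht₀⟩, Subsingleton.elim _ _, fun j => by simp⟩⟩
  have := Fintype.ofFinite {x : Fin n → ℕ // ∑ i, x i = k}
  let φ := Fintype.equivFin ({x : Fin n → ℕ // ∑ i, x i = k} ⊕ Fin n)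
  have hslack := isSlackFamily_gridRank (φ := φ)
  have ht : (Sum.inl ⟨t₀, ht₀⟩ : {x : Fin n → ℕ // ∑ i, x i = k} ⊕ Fin n) ∉
      Set.range (Sum.inr : Fin n → _) := by simp
  obtain ⟨S, hScard, hSd, hSc⟩ := exists_dominant_colourful hslack ht
    (by rw [Fintype.card_fin]; exact h2) (Sum.elim c id) (fun i => rfl)
  have hinj : Set.InjOn (Sum.elim c id) (S : Set ({x : Fin n → ℕ // ∑ i, x i = k} ⊕ Fin n)) := by
    rw [← Finset.card_image_iff, hSc, Finset.card_univ, hScard]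
  have hcol : ∀ i, Sum.inr i ∈ S ∨ ∃ y, Sum.inl y ∈ S ∧ c y = i := by
    intro i
    obtain ⟨x, hx, hxi⟩ := Finset.mem_image.1 (hSc ▸ Finset.mem_univ i : i ∈ S.image _)
    rcases x with y | j
    · exact Or.inr ⟨y, hx, hxi⟩
    · exact Or.inl ((show j = i from hxi) ▸ hx)
  obtain ⟨x₀, hx₀⟩ : ∃ x, Sum.inl x ∈ S := by
    by_contra! hno
    obtain ⟨i, hi⟩ := hSd (Sum.inl ⟨t₀, ht₀⟩)
    exact absurd (hi _ ((hcol i).resolve_right fun ⟨y, hy, _⟩ => hno y hy))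
      (not_le.2 (hslack.lowest_lt (by simp)))
  set C : Finset (Fin n) := {i | Sum.inr i ∉ S}
  have hC : C.Nonempty := by
    refine ⟨c x₀, Finset.mem_filter.2 ⟨Finset.mem_univ _, fun h => ?_⟩⟩
    exact Sum.inl_ne_inr (hinj hx₀ h rfl)
  let σ : Finset {x : Fin n → ℕ // ∑ i, x i = k} := {x | Sum.inl x ∈ S}
  have hσ : ∀ x, x ∈ σ ↔ Sum.inl x ∈ S := fun x => by simp [σ]
  have hmin : ∀ i, ∃ x ∈ σ, ∀ y ∈ σ, x.1 i ≤ y.1 i := fun i =>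
    Finset.exists_min_image σ (fun x => x.1 i) ⟨x₀, (hσ _).2 hx₀⟩
  choose b hbσ hb using hmin
  -- Otherwise some grid point exceeds every minimum `b i` on `C` by at least one; off `C` the
  -- minimum is a slack point, which every grid point beats.
  have hlow : k < ∑ i ∈ C, ((b i).1 i + 1) := by
    by_contra! hle
    obtain ⟨y, hy, hyC⟩ := exists_grid_ge _ hC hle
    obtain ⟨l, hl⟩ := hSd (Sum.inl ⟨y, hy⟩)
    by_cases hlS : Sum.inr l ∈ S
    · exact absurd (hl _ hlS) (not_le.2 (hslack.lowest_lt (by simp)))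
    · have hlC := hyC l (Finset.mem_filter.2 ⟨Finset.mem_univ _, hlS⟩)
      refine absurd (hl _ ((hσ _).1 (hbσ l))) (not_le.2 (gridRank_lt ?_))
      simp only [gridCoord]
      omega
  have hCn : C.card ≤ n := by simpa using Finset.card_le_univ C
  rw [Finset.sum_add_distrib, Finset.sum_const, smul_eq_mul, mul_one] at hlow
  -- The minima on `C` use up more than `k - C.card` of the mass `k`, leaving less than `n` for
  -- everything else.
  have hsum : ∀ x ∈ σ, ∑ i ∈ C, (x.1 i - (b i).1 i) + ∑ i ∈ Cᶜ, x.1 i ≤ n := by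
    intro x hx
    have h1 := Finset.sum_add_sum_compl C x.1
    rw [x.2] at h1
    have h3 : ∑ i ∈ C, (x.1 i - (b i).1 i) + ∑ i ∈ C, (b i).1 i = ∑ i ∈ C, x.1 i := by
      rw [← Finset.sum_add_distrib]
      exact Finset.sum_congr rfl fun i _ => Nat.sub_add_cancel (hb i x hx)
    omega
  have hin : ∀ x ∈ σ, ∀ i ∈ C, x.1 i ≤ (b i).1 i + n := by
    intro x hx i hi
    have h1 := hsum x hx
    have h3 := Finset.single_le_sum (f := fun i => x.1 i - (b i).1 i)
      (fun _ _ => Nat.zero_le _) hi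
    omega
  have hout : ∀ x ∈ σ, ∀ i, i ∉ C → x.1 i ≤ n := by
    intro x hx i hi
    have h1 := hsum x hx
    have h3 := Finset.single_le_sum (f := x.1)
      (fun _ _ => Nat.zero_le _) (Finset.mem_compl.2 hi)
    omega
  refine ⟨x₀, fun i => ?_⟩
  have hx₀σ := (hσ _).2 hx₀
  by_cases hi : i ∈ C
  · obtain ⟨y, hy, hyi⟩ := (hcol i).resolve_left (Finset.mem_filter.1 hi).2
    rw [← hσ] at hy
    refine Or.inr ⟨y, hyi, fun j => ?_⟩
    by_cases hj : j ∈ C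
    · have h1 := hin _ hx₀σ j hj
      have h3 := hin _ hy j hj
      have h4 := hb j _ hx₀σ
      have h5 := hb j _ hy
      omega
    · have h1 := hout _ hx₀σ j hj
      have h3 := hout _ hy j hj
      omega
  · exact Or.inl (hout _ hx₀σ i hi)

end Grid

/-! ### Approximate equilibria and the limit. -/

theorem isCompact_massDistributions (n : ℕ) (r : ℝ) : IsCompact (massDistributions n r) := by
  refine (isCompact_univ_pi fun _ : Fin n => isCompact_Icc (a := (0 : ℝ)) (b := r)).of_isClosed_subset
    ?_ fun x hx i _ => ⟨hx.1 i, ?_⟩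
  · have : massDistributions n r = (⋂ i, {x | 0 ≤ x i}) ∩ {x | ∑ i, x i = r} := by
      ext x
      simp [massDistributions]
    rw [this]
    exact (isClosed_iInter fun i => isClosed_le continuous_const (continuous_apply i)).inter
      (isClosed_eq (by fun_prop) continuous_const)
  · rw [← hx.2]
    exact Finset.single_le_sum (fun j _ => hx.1 j) (Finset.mem_univ i)

/-- The mass distribution obtained by rescaling a grid point. -/
noncomputable def gridPoint {n k : ℕ} {r : ℝ} (hr : 0 < r) (hk : 0 < k)
    (x : {x : Fin n → ℕ // ∑ i, x i = k}) : massDistributions n r :=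
  ⟨fun i => x.1 i * (r / k), fun i => by positivity, by
    rw [← Finset.sum_mul, ← Nat.cast_sum, x.2]
    field_simp⟩

/-- Approximate equilibria: near some mass distribution, every vertex that carries more than a small
mass is cheapest somewhere. -/
theorem NBG.exists_approx_equilibrium (G : NBG) {ε : ℝ} (hε : 0 < ε) :
    ∃ x : massDistributions G.n G.r, ∀ i, x.1 i < ε ∨
      ∃ y, dist y x < ε ∧ ∀ j, G.C i y ≤ G.C j y := by
  have hr := G.r_pos
  -- With this `k`, a deviation of `n` grid steps rescales to less than `ε`.
  obtain ⟨k, hk⟩ := exists_nat_gt (G.n * G.r / ε)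
  have hk0 : (0 : ℝ) < k := lt_of_le_of_lt (by positivity) hk
  have hkn : 0 < k := Nat.cast_pos.1 hk0
  have hsmall : G.n * (G.r / k) < ε := by
    rw [div_lt_iff₀ hε] at hk
    rw [← mul_div_assoc, div_lt_iff₀ hk0]
    linarith
  have : Nonempty (Fin G.n) := ⟨⟨0, G.one_le_n⟩⟩
  have hcheap : ∀ x : {x : Fin G.n → ℕ // ∑ i, x i = k}, ∃ i, ∀ j,
      G.C i (gridPoint hr hkn x) ≤ G.C j (gridPoint hr hkn x) := fun x =>
    Finite.exists_min fun i => G.C i (gridPoint hr hkn x)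
  choose c hc using hcheap
  obtain ⟨x, hx⟩ := exists_grid_cluster G.one_le_n c
  refine ⟨gridPoint hr hkn x, fun i => (hx i).imp (fun h => ?_) ?_⟩
  · refine lt_of_le_of_lt (mul_le_mul_of_nonneg_right ?_ (by positivity)) hsmall
    exact_mod_cast h
  · rintro ⟨y, rfl, hy⟩
    refine ⟨gridPoint hr hkn y, ?_, hc y⟩
    rw [Subtype.dist_eq, dist_pi_lt_iff hε]
    intro j
    refine lt_of_le_of_lt ?_ hsmall
    simp only [gridPoint, Real.dist_eq, ← sub_mul, abs_mul]
    rw [abs_of_nonneg (show 0 ≤ G.r / k by positivity)]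
    refine mul_le_mul_of_nonneg_right ?_ (by positivity)
    obtain ⟨h1, h2⟩ := hy j
    have h1' : (y.1 j : ℝ) ≤ x.1 j + G.n := by exact_mod_cast h1
    have h2' : (x.1 j : ℝ) ≤ y.1 j + G.n := by exact_mod_cast h2
    rw [abs_le]
    constructor <;> linarith

theorem mainTheorem1 (G : NBG) (hC : ∀ i : Fin G.n, Continuous (G.C i)) :
    ∃ x : massDistributions G.n G.r, G.IsEquilibrium x := by
  have : CompactSpace (massDistributions G.n G.r) :=
    isCompact_iff_compactSpace.1 (isCompact_massDistributions _ _)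
  choose x hx using fun m : ℕ => G.exists_approx_equilibrium (Nat.one_div_pos_of_nat (n := m))
  obtain ⟨a, φ, hφ, hlim⟩ := CompactSpace.tendsto_subseq x
  refine ⟨a, fun i j hi => ?_⟩
  by_contra! hlt
  -- A strict cost inequality at `a` persists on a ball, but that ball contains a point `y` where
  -- `i` is cheapest.
  obtain ⟨δ, hδ, hball⟩ := Metric.isOpen_iff.1 (isOpen_lt (hC j) (hC i)) a hlt
  have hi : 0 < a.1 i := hi
  have hcoord : Filter.Tendsto (fun m => (x (φ m)).1 i) Filter.atTop (nhds (a.1 i)) :=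
    (((continuous_apply i).comp continuous_subtype_val).tendsto a).comp hlim
  have hε : Filter.Tendsto (fun m => 1 / ((φ m : ℝ) + 1)) Filter.atTop (nhds 0) :=
    tendsto_one_div_add_atTop_nhds_zero_nat.comp hφ.tendsto_atTop
  obtain ⟨m, h1, h2, h3⟩ := ((hε.eventually_lt_const (half_pos hδ)).and
    ((hε.eventually_lt hcoord hi).and (hlim.eventually (Metric.ball_mem_nhds a (half_pos hδ))))).exists
  obtain ⟨y, hy, hyi⟩ := (hx (φ m) i).resolve_left (not_lt.2 h2.le)
  have h3 : dist (x (φ m)) a < δ / 2 := h3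
  have hya : dist y a < δ := by
    have := dist_triangle y (x (φ m)) a
    linarith
  exact absurd (hyi j) (not_le.2 (hball hya))
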